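/- For $n\ge 1$ let $S$ be a regular $n$-simplex in $\mathbb{R}^n$ of edge length $2$ with vertices $V_1,\dots,V_{n+1}$, let $T$ be the union over $i$ of the intersections of $S$ with the ball of radius $1$ centred at $V_i$, and let the Rogers constant be $\sigma_n=\operatorname{vol}(T)/\operatorname{vol}(S)$ (it does not depend on the choice of $S$). For integers $r,s\ge 0$ with $n=r+2s$ put $$\delta_1^*(n)=\frac{n!}{n^n}\left(\frac{4}{\pi}\right)^{s},\qquad \delta_2^*(n)=\sigma_n\left(\frac{4}{\pi n}\right)^{n/2}\Gamma\left(1+\frac n2\right).$$ 1. For all $n\ge 1$, $$\sigma_n\le\left(\frac{e}{4n}\right)^{n/2}\frac{(n+1)!}{\Gamma\left(1+\frac n2\right)}.$$ 2. For all $n\ge 56$ and all integers $r,s\ge 0$ with $n=r+2s$, $\delta_2^*(n)\le\delta_1^*(n)$. 3. Let $K$ be a number field of degree $n\ge 56$ with $s$ pairs of complex embeddings, discriminant $\Delta$ and ring of integers $\mathcal{O}_K$, and let $M$ be the largest cardinality of a finite set of elements of $\mathcal{O}_K$ whose pairwise differences (of distinct elements) are all units. If $M>\delta_1^*(n)\sqrt{|\Delta|}$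 (the cross-polytope form of Lenstra's criterion), then $M>\delta_2^*(n)\sqrt{|\Delta|}$ (the sphere form). -/

import Mathlib

namespace Lenstra

open MeasureTheory

/-- `n + 1` points of `ℝⁿ` at mutual distance `2`, that is, the vertices of a regular `n`-simplex
of edge length `2` (affine independence is automatic, see `IsRegularTwo.affineIndependent`). -/
def IsRegularTwo {n : ℕ} (V : Fin (n + 1) → EuclideanSpace ℝ (Fin n)) : Prop :=
  ∀ i j, i ≠ j → dist (V i) (V j) = 2

/-- The (solid) simplex `S` with vertices `V 0, …, V n`. -/
def solidSimplex {n : ℕ} (V : Fin (n + 1) → EuclideanSpace ℝ (Fin n)) :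
    Set (EuclideanSpace ℝ (Fin n)) :=
  convexHull ℝ (Set.range V)

/-- The part `T` of the simplex covered by the balls of radius `1` centred at its vertices. -/
def coveredPart {n : ℕ} (V : Fin (n + 1) → EuclideanSpace ℝ (Fin n)) :
    Set (EuclideanSpace ℝ (Fin n)) :=
  ⋃ i, solidSimplex V ∩ Metric.closedBall (V i) 1

/-- `vol T / vol S` for the simplex with vertices `V 0, …, V n`. -/
noncomputable def coveredRatio {n : ℕ} (V : Fin (n + 1) → EuclideanSpace ℝ (Fin n)) : ℝ :=
  volume.real (coveredPart V) / volume.real (solidSimplex V)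

/-- The vertices of a concrete regular simplex of edge length `2` in `ℝⁿ`: the vectors `√2 • eᵢ`
and the point on the diagonal with all coordinates equal to `√2 (1 + √(n + 1)) / n`. -/
noncomputable def regularVertices (n : ℕ) : Fin (n + 1) → EuclideanSpace ℝ (Fin n) :=
  Fin.cons (WithLp.toLp 2 fun _ => √2 * (1 + √((n : ℝ) + 1)) / (n : ℝ))
    fun i => EuclideanSpace.single i √2

/-- The Rogers constant `σ_n = vol T / vol S`, for a regular `n`-simplex `S` of edge length `2`
in `ℝⁿ`. It does not depend on the choice of `S`, see `coveredRatio_eq_rogersConstant`. -/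
noncomputable def rogersConstant (n : ℕ) : ℝ :=
  coveredRatio (regularVertices n)

/-- `δ*_1(n) = (n! / nⁿ) (4 / π)ˢ`, for `s` pairs of complex embeddings. -/
noncomputable def deltaStarOne (n s : ℕ) : ℝ :=
  (n.factorial : ℝ) / (n : ℝ) ^ n * (4 / Real.pi) ^ s

/-- `δ*_2(n) = σ_n (4 / (π n))^(n/2) Γ(1 + n/2)`. -/
noncomputable def deltaStarTwo (n : ℕ) : ℝ :=
  rogersConstant n * (4 / (Real.pi * n)) ^ ((n : ℝ) / 2) * Real.Gamma (1 + (n : ℝ) / 2)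

/-- A finite set of algebraic integers whose differences of distinct elements are all units. -/
def IsExceptional (K : Type*) [Field K] (A : Finset (NumberField.RingOfIntegers K)) : Prop :=
  ∀ x ∈ A, ∀ y ∈ A, x ≠ y → IsUnit (x - y)

/-- `M`, the largest cardinality of a set of algebraic integers of `K` whose differences of
distinct elements are all units. For a number field the supremum is over a bounded set, see
`bddAbove_exceptional`, hence attained. -/
noncomputable def exceptionalNumber (K : Type*) [Field K] : ℕ :=
  sSup {m : ℕ | ∃ A : Finset (NumberField.RingOfIntegers K), IsExceptional K A ∧ A.card = m}

/-- The cross-polytope form of Lenstra's criterion: `M > δ*_1(n) √|Δ|`. -/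
def CrossPolytopeCriterion (K : Type*) [Field K] [NumberField K] : Prop :=
  deltaStarOne (Module.finrank ℚ K) (NumberField.InfinitePlace.nrComplexPlaces K) *
    √|(NumberField.discr K : ℝ)| < (exceptionalNumber K : ℝ)

/-- The sphere form of Lenstra's criterion: `M > δ*_2(n) √|Δ|`. -/
def SphereCriterion (K : Type*) [Field K] [NumberField K] : Prop :=
  deltaStarTwo (Module.finrank ℚ K) * √|(NumberField.discr K : ℝ)| < (exceptionalNumber K : ℝ)

/-! Well-definedness of the Rogers constant and of `M`. -/

theorem isRegularTwo_regularVertices {n : ℕ} (hn : 1 ≤ n) : IsRegularTwo (regularVertices n) := by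
  have hn0 : (n : ℝ) ≠ 0 := by positivity
  have h2 : √2 * √2 = (2 : ℝ) := Real.mul_self_sqrt (by norm_num)
  have hs : √((n : ℝ) + 1) * √((n : ℝ) + 1) = n + 1 := Real.mul_self_sqrt (by positivity)
  have key : ∀ i : Fin n, dist (regularVertices n 0) (regularVertices n i.succ) = 2 := by
    intro i
    have h4 : (2 : ℝ) = √4 := by
      rw [show (4 : ℝ) = 2 ^ 2 by norm_num, Real.sqrt_sq (by norm_num)]
    rw [EuclideanSpace.dist_eq, h4]
    congr 1
    simp only [regularVertices, Fin.cons_zero, Fin.cons_succ, PiLp.single_apply,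
      Real.dist_eq, sq_abs]
    rw [← Finset.add_sum_erase _ _ (Finset.mem_univ i)]
    rw [Finset.sum_congr rfl (g := fun _ => (√2 * (1 + √((n : ℝ) + 1)) / (n : ℝ)) ^ 2)
      (fun j hj => by simp [Finset.ne_of_mem_erase hj])]
    rw [Finset.sum_const, Finset.card_erase_of_mem (Finset.mem_univ i), Finset.card_univ,
      Fintype.card_fin, nsmul_eq_mul, Nat.cast_sub hn]
    simp only [if_true]
    field_simp
    push_cast
    generalize √((n : ℝ) + 1) = b at *
    generalize √(2 : ℝ) = a at *
    generalize (n : ℝ) = x at *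
    linear_combination (x ^ 2 - 2 * x * (1 + b) + x * (1 + b) ^ 2) * h2 + (2 * x) * hs
  intro i j hij
  induction i using Fin.cases with
  | zero =>
    induction j using Fin.cases with
    | zero => exact absurd rfl hij
    | succ j => exact key j
  | succ i =>
    induction j using Fin.cases with
    | zero => rw [dist_comm]; exact key i
    | succ j =>
      have hij' : i ≠ j := fun h => hij (by rw [h])
      simp only [regularVertices, Fin.cons_succ]
      rw [EuclideanSpace.dist_eq, ← Finset.add_sum_erase _ _ (Finset.mem_univ i),
        ← Finset.add_sum_erase _ _ (Finset.mem_erase.2 ⟨hij'.symm, Finset.mem_univ j⟩),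
        Finset.sum_eq_zero]
      · simp only [PiLp.single_apply, Real.dist_eq, sq_abs, if_true, hij', hij'.symm,
          if_false, sub_zero, zero_sub, even_two, Even.neg_pow, add_zero]
        rw [show √2 ^ 2 + √2 ^ 2 = (2 : ℝ) ^ 2 by nlinarith, Real.sqrt_sq (by norm_num)]
      · intro k hk
        simp only [Finset.mem_erase, Finset.mem_univ, and_true] at hk
        simp [hk.1, hk.2]

theorem IsRegularTwo.norm_sq {n : ℕ} {V : Fin (n + 1) → EuclideanSpace ℝ (Fin n)}
    (hV : IsRegularTwo V) (w : Fin (n + 1) → ℝ) (hw : ∑ i, w i = 0) :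
    ‖∑ i, w i • V i‖ ^ 2 = 2 * ∑ i, w i ^ 2 := by
  have h := EuclideanGeometry.inner_weightedVSub (s₁ := Finset.univ) (s₂ := Finset.univ)
    V hw V hw
  rw [Finset.weightedVSub_eq_linear_combination _ hw, real_inner_self_eq_norm_sq] at h
  rw [h]
  have h1 : ∀ i, ∑ j, w i * w j * (dist (V i) (V j) * dist (V i) (V j)) = -4 * w i ^ 2 := by
    intro i
    have : ∀ j, w i * w j * (dist (V i) (V j) * dist (V i) (V j)) =
        4 * w i * w j - if i = j then 4 * w i ^ 2 else 0 := by
      intro j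
      by_cases hij : i = j
      · subst hij; simp; ring
      · rw [hV i j hij]; simp [hij]; ring
    simp_rw [this]
    rw [Finset.sum_sub_distrib, ← Finset.mul_sum, hw]
    simp
  simp_rw [h1]
  rw [← Finset.mul_sum]
  ring

theorem IsRegularTwo.affineIndependent {n : ℕ} {V : Fin (n + 1) → EuclideanSpace ℝ (Fin n)}
    (hV : IsRegularTwo V) : AffineIndependent ℝ V := by
  rw [affineIndependent_iff_of_fintype]
  intro w hw h i
  rw [Finset.weightedVSub_eq_linear_combination _ hw] at h
  have := hV.norm_sq w hw
  rw [h] at this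
  have h0 : ∑ i, w i ^ 2 = 0 := by simpa using this.symm
  have := (Finset.sum_eq_zero_iff_of_nonneg (fun i _ => sq_nonneg (w i))).1 h0 i
    (Finset.mem_univ i)
  exact pow_eq_zero_iff (two_ne_zero) |>.1 this

/-- The vertices of a regular simplex as an affine basis. -/
def IsRegularTwo.basis {n : ℕ} {V : Fin (n + 1) → EuclideanSpace ℝ (Fin n)}
    (hV : IsRegularTwo V) : AffineBasis (Fin (n + 1)) ℝ (EuclideanSpace ℝ (Fin n)) where
  toFun := V
  ind' := hV.affineIndependent
  tot' := by
    rw [hV.affineIndependent.affineSpan_eq_top_iff_card_eq_finrank_add_one]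
    simp

theorem IsRegularTwo.volume_pos {n : ℕ} {V : Fin (n + 1) → EuclideanSpace ℝ (Fin n)}
    (hV : IsRegularTwo V) : 0 < volume.real (solidSimplex V) := by
  have hb : Bornology.IsBounded (solidSimplex V) :=
    isBounded_convexHull.2 (Set.finite_range V).isBounded
  refine ENNReal.toReal_pos (ne_of_gt ?_) hb.measure_lt_top.ne
  refine Measure.measure_pos_of_nonempty_interior _ ?_
  exact interior_convexHull_nonempty_iff_affineSpan_eq_top.2 hV.basis.tot

theorem coveredRatio_eq {n : ℕ} {V W : Fin (n + 1) → EuclideanSpace ℝ (Fin n)}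
    (hV : IsRegularTwo V) (hW : IsRegularTwo W) : coveredRatio V = coveredRatio W := by
  set b := hV.basis with hb
  have hbV : ∀ i, b i = V i := fun i => rfl
  let f : EuclideanSpace ℝ (Fin n) →ᵃ[ℝ] EuclideanSpace ℝ (Fin n) :=
    (Fintype.linearCombination ℝ W).toAffineMap.comp b.coords
  have hf : ∀ x, f x = ∑ i, b.coord i x • W i := fun x => by
    simp [f, Fintype.linearCombination_apply]
  have hfV : ∀ i, f (V i) = W i := fun i => by
    rw [hf, ← hbV i]
    simp [AffineBasis.coord_apply]
  have hiso : Isometry f := by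
    refine Isometry.of_dist_eq fun x y => ?_
    have hsum : ∑ i, (b.coord i x - b.coord i y) = 0 := by
      rw [Finset.sum_sub_distrib, b.sum_coord_apply_eq_one, b.sum_coord_apply_eq_one, sub_self]
    have h1 := hW.norm_sq _ hsum
    have h2 := hV.norm_sq _ hsum
    simp_rw [sub_smul, Finset.sum_sub_distrib] at h1 h2
    have hx := b.linear_combination_coord_eq_self x
    have hy := b.linear_combination_coord_eq_self y
    simp_rw [hbV] at hx hy
    rw [hx, hy] at h2
    rw [← hf, ← hf, ← h2] at h1
    rw [dist_eq_norm, dist_eq_norm]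
    exact (sq_eq_sq₀ (norm_nonneg _) (norm_nonneg _)).1 h1
  have hvol : ∀ s : Set (EuclideanSpace ℝ (Fin n)), volume.real (f '' s) = volume.real s := by
    intro s
    rw [Measure.real, Measure.real, ← EuclideanSpace.euclideanHausdorffMeasure_eq_volume,
      hiso.euclideanHausdorffMeasure_image]
  have hS : f '' solidSimplex V = solidSimplex W := by
    rw [solidSimplex, solidSimplex, AffineMap.image_convexHull, ← Set.range_comp]
    congr 2
    exact funext hfV
  have hT : f '' coveredPart V = coveredPart W := by
    rw [coveredPart, coveredPart, Set.image_iUnion]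
    refine Set.iUnion_congr fun i => ?_
    rw [← hiso.preimage_closedBall, Set.image_inter_preimage, hS, hfV]
  rw [coveredRatio, coveredRatio, ← hS, ← hT, hvol, hvol]

theorem coveredRatio_eq_rogersConstant {n : ℕ} (hn : 1 ≤ n)
    {V : Fin (n + 1) → EuclideanSpace ℝ (Fin n)} (hV : IsRegularTwo V) :
    coveredRatio V = rogersConstant n :=
  coveredRatio_eq hV (isRegularTwo_regularVertices hn)

theorem bddAbove_exceptional (K : Type*) [Field K] [NumberField K] :
    BddAbove {m : ℕ | ∃ A : Finset (NumberField.RingOfIntegers K),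
      IsExceptional K A ∧ A.card = m} := by
  have hne : Ideal.span {(2 : NumberField.RingOfIntegers K)} ≠ ⊥ := by
    simp
  have : Finite (NumberField.RingOfIntegers K ⧸ Ideal.span {(2 : NumberField.RingOfIntegers K)}) :=
    Ideal.finiteQuotientOfFreeOfNeBot _ hne
  have hnu : ¬ IsUnit (2 : NumberField.RingOfIntegers K) := by
    intro h
    have h' : IsUnit (algebraMap ℤ (NumberField.RingOfIntegers K) 2) := by simpa using h
    have h3 : IsUnit (2 : ℤ) := isUnit_of_map_unit _ _ h'
    exact absurd h3 (by decide)
  refine ⟨Nat.card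
    (NumberField.RingOfIntegers K ⧸ Ideal.span {(2 : NumberField.RingOfIntegers K)}), ?_⟩
  rintro m ⟨A, hA, rfl⟩
  rw [← Nat.card_eq_finsetCard]
  refine Nat.card_le_card_of_injective (fun x : A =>
    Ideal.Quotient.mk (Ideal.span {(2 : NumberField.RingOfIntegers K)}) x.1) ?_
  intro x y hxy
  by_contra hne'
  have hu := hA x.1 x.2 y.1 y.2 fun h => hne' (Subtype.ext h)
  have hd := Ideal.mem_span_singleton.1 (Ideal.Quotient.eq.1 hxy)
  exact hnu (isUnit_of_dvd_unit hd hu)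

end Lenstra

/-! ### Exponential integrals over cones and the volumes they give. -/

namespace Lenstra

open MeasureTheory Module Set
open scoped ENNReal Pointwise

/-! The covered part is a union of `n + 1` caps. In edge coordinates at a vertex, each cap lies in
the region of the orthant where `cornerForm` is at most 1, while the simplex contains the corner
simplex of volume `1 / n!`. The Jacobian cancels, so `σ_n` is at most `(n + 1)!` times the volume of
that region (`IsRegularTwo.volume_inter_closedBall_le`). That volume times `Γ(1 + n/2)` is the
integral of `exp (-cornerForm)` over the orthant. Bounding the form below by an affine function of
`∑ tᵢ` leaves a product of one-dimensional integrals, which gives `(e / 4n)^(n/2)`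
(`Gamma_mul_volume_cornerForm_le_one_le`). In `δ*_2` the Gamma factors then cancel, and the
comparison with `δ*_1` reduces to `(n + 1)(e/π)^(n/2) ≤ 1`, since `4/π ≥ 1`. The statement on number
fields follows by multiplying by `√|Δ|`. -/

theorem lintegral_exp_neg_Ici (a : ℝ) :
    ∫⁻ u in Ici a, ENNReal.ofReal (Real.exp (-u)) = ENNReal.ofReal (Real.exp (-a)) := by
  rw [setLIntegral_congr Ioi_ae_eq_Ici.symm, ← integral_exp_neg_Ioi a,
    ofReal_integral_eq_lintegral_ofReal (integrableOn_exp_neg_Ioi a)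
      (Filter.Eventually.of_forall fun _ => (Real.exp_pos _).le)]

/-- Layer cake: write `e^(-q)` as the integral of `e^(-u)` over `u ≥ q` and apply Tonelli. By
homogeneity the sublevel set at `u` is a dilate by `u^(1/p)`, so its measure scales as `u^(dim/p)`
and a Gamma integral remains. -/
theorem setLIntegral_exp_neg_of_homogeneous {E : Type*} [NormedAddCommGroup E] [NormedSpace ℝ E]
    [FiniteDimensional ℝ E] [MeasurableSpace E] [BorelSpace E] (μ : Measure E)
    [μ.IsAddHaarMeasure] {p : ℝ} (hp : 0 < p) {C : Set E} (hC : MeasurableSet C) {q : E → ℝ}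
    (hq : Measurable q) (hq0 : ∀ x ∈ C, 0 ≤ q x)
    (hCsmul : ∀ c : ℝ, 0 < c → ∀ x ∈ C, c • x ∈ C)
    (hqsmul : ∀ c : ℝ, 0 < c → ∀ x, q (c • x) = c ^ p * q x) :
    ∫⁻ x in C, ENNReal.ofReal (Real.exp (-q x)) ∂μ =
      ENNReal.ofReal (Real.Gamma (finrank ℝ E / p + 1)) * μ (C ∩ {x | q x ≤ 1}) := by
  have hlevel : ∀ u : ℝ, 0 < u → μ (C ∩ {x | q x ≤ u}) =
      ENNReal.ofReal (u ^ (finrank ℝ E / p)) * μ (C ∩ {x | q x ≤ 1}) := by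
    intro u hu
    have hc : 0 < u ^ (1 / p) := Real.rpow_pos_of_pos hu _
    have hcp : (u ^ (1 / p)) ^ p = u := by
      rw [← Real.rpow_mul hu.le, one_div_mul_cancel hp.ne', Real.rpow_one]
    have hset : C ∩ {x | q x ≤ u} = (u ^ (1 / p)) • (C ∩ {x | q x ≤ 1}) := by
      ext x
      rw [Set.mem_smul_set_iff_inv_smul_mem₀ hc.ne']
      have hx : q x = u * q ((u ^ (1 / p))⁻¹ • x) := by
        conv_lhs => rw [← smul_inv_smul₀ hc.ne' x, hqsmul _ hc, hcp]
      constructor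
      · rintro ⟨h1, h2⟩
        refine ⟨hCsmul _ (inv_pos.2 hc) _ h1, ?_⟩
        rw [mem_ofPred_eq, hx] at h2
        exact le_of_mul_le_mul_left (by simpa using h2) hu
      · rintro ⟨h1, h2⟩
        refine ⟨by simpa only [smul_inv_smul₀ hc.ne'] using hCsmul _ hc _ h1, ?_⟩
        rw [mem_ofPred_eq, hx]
        exact mul_le_of_le_one_right hu.le h2
    rw [hset, Measure.addHaar_smul, abs_of_pos (pow_pos hc _), ← Real.rpow_natCast,
      ← Real.rpow_mul hu.le, one_div_mul_eq_div]
  have hmeas : Measurable fun z : E × ℝ => {z : E × ℝ | q z.1 ≤ z.2}.indicator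
      (fun z => ENNReal.ofReal (Real.exp (-z.2))) z := by
    refine Measurable.indicator (by fun_prop) ?_
    exact measurableSet_le (hq.comp measurable_fst) measurable_snd
  calc ∫⁻ x in C, ENNReal.ofReal (Real.exp (-q x)) ∂μ
      = ∫⁻ x in C, (∫⁻ u in Ioi (0 : ℝ), {z : E × ℝ | q z.1 ≤ z.2}.indicator
          (fun z => ENNReal.ofReal (Real.exp (-z.2))) (x, u)) ∂μ := by
        refine setLIntegral_congr_fun hC fun x hx => ?_
        have : ∀ u : ℝ, {z : E × ℝ | q z.1 ≤ z.2}.indicator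
            (fun z => ENNReal.ofReal (Real.exp (-z.2))) (x, u) =
            (Ici (q x)).indicator (fun u => ENNReal.ofReal (Real.exp (-u))) u := fun u => by
          simp [Set.indicator]
        simp_rw [this]
        rw [setLIntegral_congr Ioi_ae_eq_Ici, setLIntegral_indicator measurableSet_Ici,
          Ici_inter_Ici, sup_eq_left.2 (hq0 x hx), lintegral_exp_neg_Ici]
    _ = ∫⁻ u in Ioi (0 : ℝ), (∫⁻ x in C, {z : E × ℝ | q z.1 ≤ z.2}.indicator
          (fun z => ENNReal.ofReal (Real.exp (-z.2))) (x, u) ∂μ) :=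
        lintegral_lintegral_swap hmeas.aemeasurable
    _ = ∫⁻ u in Ioi (0 : ℝ),
          ENNReal.ofReal (Real.exp (-u) * u ^ (finrank ℝ E / p + 1 - 1)) *
            μ (C ∩ {x | q x ≤ 1}) := by
        refine setLIntegral_congr_fun measurableSet_Ioi fun u hu => ?_
        have : ∀ x : E, {z : E × ℝ | q z.1 ≤ z.2}.indicator
            (fun z => ENNReal.ofReal (Real.exp (-z.2))) (x, u) =
            {x | q x ≤ u}.indicator (fun _ => ENNReal.ofReal (Real.exp (-u))) x := fun x => by
          simp [Set.indicator]
        simp_rw [this]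
        rw [lintegral_indicator_const (measurableSet_le hq measurable_const),
          Measure.restrict_apply (measurableSet_le hq measurable_const), inter_comm,
          hlevel u hu, ← mul_assoc, ← ENNReal.ofReal_mul (Real.exp_pos _).le, add_sub_cancel_right]
    _ = _ := by
        have hs : 0 < (finrank ℝ E : ℝ) / p + 1 := by positivity
        rw [lintegral_mul_const _ (by fun_prop), Real.Gamma_eq_integral hs,
          ofReal_integral_eq_lintegral_ofReal (Real.GammaIntegral_convergent hs)]
        filter_upwards [ae_restrict_mem measurableSet_Ioi] with u hu
        exact mul_nonneg (Real.exp_pos _).le (Real.rpow_nonneg (le_of_lt hu) _)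

/-- The closed positive orthant. -/
def orthant (n : ℕ) : Set (EuclideanSpace ℝ (Fin n)) := {t | ∀ i, 0 ≤ t i}

theorem measurableSet_orthant (n : ℕ) : MeasurableSet (orthant n) := by
  have : orthant n = ⋂ i, {t : EuclideanSpace ℝ (Fin n) | 0 ≤ t i} := by
    ext; simp [orthant]
  rw [this]
  exact MeasurableSet.iInter fun i => measurableSet_le measurable_const (by fun_prop)

theorem smul_mem_orthant {n : ℕ} (c : ℝ) (hc : 0 < c) (x : EuclideanSpace ℝ (Fin n))
    (hx : x ∈ orthant n) : c • x ∈ orthant n :=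
  fun i => mul_nonneg hc.le (hx i)

theorem setLIntegral_orthant_exp_neg_mul_sum (n : ℕ) {b : ℝ} (hb : 0 < b) :
    ∫⁻ t in orthant n, ENNReal.ofReal (Real.exp (-(b * ∑ i, t i))) =
      ENNReal.ofReal ((1 / b) ^ n) := by
  have hint : Integrable (fun u : ℝ => Real.exp (-b * u)) (volume.restrict (Ici 0)) := by
    have := integrableOn_exp_mul_Ioi (neg_lt_zero.2 hb) 0
    rwa [← integrableOn_Ici_iff_integrableOn_Ioi] at this
  have hval : ∫ u in Ici (0 : ℝ), Real.exp (-b * u) = 1 / b := by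
    rw [integral_Ici_eq_integral_Ioi, integral_exp_mul_Ioi (neg_lt_zero.2 hb)]
    simp
  have hpre : WithLp.toLp 2 ⁻¹' orthant n = Set.univ.pi fun _ : Fin n => Ici (0 : ℝ) := by
    ext; simp [orthant, Pi.le_def]
  rw [← (PiLp.volume_preserving_toLp (Fin n)).setLIntegral_comp_preimage (measurableSet_orthant n)
    (by fun_prop), hpre, volume_pi, Measure.restrict_pi_pi]
  have hexp : ∀ t : Fin n → ℝ, Real.exp (-(b * ∑ i, (WithLp.toLp 2 t) i)) =
      ∏ i, Real.exp (-b * t i) := fun t => by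
    rw [← Real.exp_sum, ← Finset.mul_sum, neg_mul]
  simp_rw [hexp]
  rw [← ofReal_integral_eq_lintegral_ofReal (Integrable.fintype_prod fun _ => hint)
      (Filter.Eventually.of_forall fun _ => Finset.prod_nonneg fun _ _ => (Real.exp_pos _).le),
    integral_fintype_prod_eq_prod (f := fun _ u => Real.exp (-b * u)), hval]
  simp

/-- The standard corner simplex has volume `1 / n!`. -/
theorem factorial_mul_volume_orthant_sum_le_one (n : ℕ) :
    ENNReal.ofReal (n.factorial : ℝ) * volume (orthant n ∩ {t | ∑ i, t i ≤ 1}) = 1 := by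
  -- The integral of `exp (-∑ tᵢ)` is computed twice: by homogeneity of degree 1, and as a product.
  have h := setLIntegral_exp_neg_of_homogeneous
    (volume : Measure (EuclideanSpace ℝ (Fin n))) one_pos (measurableSet_orthant n)
    (q := fun t => ∑ i, t i) (by fun_prop) (fun x hx => Finset.sum_nonneg fun i _ => hx i)
    smul_mem_orthant (fun c _ x => by simp [Finset.mul_sum])
  have h1 := setLIntegral_orthant_exp_neg_mul_sum n one_pos
  simp only [one_mul] at h1
  rw [h1] at h
  simpa [Real.Gamma_nat_eq_factorial] using h.symm

/-- The squared length of `∑ i, t i • (V i - V 0)` for a regular simplex of edge length `2`. -/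
noncomputable def cornerForm {n : ℕ} (t : EuclideanSpace ℝ (Fin n)) : ℝ :=
  2 * (∑ i, t i ^ 2 + (∑ i, t i) ^ 2)

theorem Gamma_mul_volume_cornerForm_le_one_le {n : ℕ} (hn : 1 ≤ n) :
    ENNReal.ofReal (Real.Gamma (1 + (n : ℝ) / 2)) *
        volume (orthant n ∩ {t | cornerForm t ≤ 1}) ≤
      ENNReal.ofReal ((Real.exp 1 / (4 * (n : ℝ))) ^ ((n : ℝ) / 2)) := by
  have hn0 : (0 : ℝ) < n := by positivity
  have h := setLIntegral_exp_neg_of_homogeneous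
    (volume : Measure (EuclideanSpace ℝ (Fin n))) two_pos (measurableSet_orthant n)
    (q := cornerForm) (by unfold cornerForm; fun_prop)
    (fun x _ => by unfold cornerForm; positivity)
    smul_mem_orthant (fun c _ x => by
      simp only [cornerForm, PiLp.smul_apply, smul_eq_mul, mul_pow, ← Finset.mul_sum]
      norm_num
      ring)
  rw [finrank_euclideanSpace_fin, add_comm] at h
  rw [← h]
  have hs : √(n : ℝ) ^ 2 = n := Real.sq_sqrt hn0.le
  have hs0 : 0 < √(n : ℝ) := Real.sqrt_pos.2 hn0
  calc ∫⁻ t in orthant n, ENNReal.ofReal (Real.exp (-cornerForm t))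
      ≤ ∫⁻ t in orthant n, ENNReal.ofReal (Real.exp (n / 2)) *
          ENNReal.ofReal (Real.exp (-(2 * √(n : ℝ) * ∑ i, t i))) := by
        refine lintegral_mono fun t => ?_
        rw [← ENNReal.ofReal_mul (Real.exp_pos _).le, ← Real.exp_add]
        refine ENNReal.ofReal_le_ofReal (Real.exp_le_exp.2 ?_)
        have : 0 ≤ ∑ i, t i ^ 2 := by positivity
        unfold cornerForm
        -- With `S = ∑ tᵢ`, drop `∑ tᵢ²` and use `2S² ≥ 2aS - a²/2`. The resulting bound `e^(a²/2)
        -- (2a)^(-n)` is smallest at `a = √n`.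
        nlinarith [sq_nonneg (2 * ∑ i, t i - √(n : ℝ))]
    _ = _ := by
        rw [lintegral_const_mul _ (by fun_prop),
          setLIntegral_orthant_exp_neg_mul_sum n (by positivity),
          ← ENNReal.ofReal_mul (Real.exp_pos _).le]
        congr 1
        have h4 : (4 * n : ℝ) ^ ((n : ℝ) / 2) = (2 * √(n : ℝ)) ^ n := by
          rw [show (4 * n : ℝ) = (2 * √(n : ℝ)) ^ (2 : ℝ) by
              rw [Real.rpow_two, mul_pow, hs]; norm_num,
            ← Real.rpow_mul (by positivity), mul_div_cancel₀ _ two_ne_zero, Real.rpow_natCast]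
        rw [Real.div_rpow (Real.exp_pos _).le (by positivity), h4, Real.exp_one_rpow,
          one_div, inv_pow, ← div_eq_mul_inv]

end Lenstra

/-! ### Corner coordinates of the simplex and the bound on the Rogers constant. -/

namespace Lenstra

open MeasureTheory Set

/-- The linear map sending the coordinate vectors to the edges of the simplex issuing from `V i`. -/
noncomputable def cornerMap {n : ℕ} (V : Fin (n + 1) → EuclideanSpace ℝ (Fin n))
    (i : Fin (n + 1)) : EuclideanSpace ℝ (Fin n) →ₗ[ℝ] EuclideanSpace ℝ (Fin n) :=
  ∑ j, (EuclideanSpace.proj j : EuclideanSpace ℝ (Fin n) →L[ℝ] ℝ).toLinearMap.smulRight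
    (V (i.succAbove j) - V i)

theorem cornerMap_apply {n : ℕ} (V : Fin (n + 1) → EuclideanSpace ℝ (Fin n))
    (i : Fin (n + 1)) (t : EuclideanSpace ℝ (Fin n)) :
    cornerMap V i t = ∑ j, t j • (V (i.succAbove j) - V i) := by
  simp [cornerMap]

/-- The barycentric weights, summing to zero, of the vector with corner coordinates `t`. -/
def cornerWeights {n : ℕ} (i : Fin (n + 1)) (t : EuclideanSpace ℝ (Fin n)) : Fin (n + 1) → ℝ :=
  i.insertNth (-∑ j, t j) t

theorem sum_cornerWeights {n : ℕ} (i : Fin (n + 1)) (t : EuclideanSpace ℝ (Fin n)) :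
    ∑ k, cornerWeights i t k = 0 := by
  simp [cornerWeights, Fin.sum_univ_succAbove _ i]

theorem sum_cornerWeights_smul {n : ℕ} (V : Fin (n + 1) → EuclideanSpace ℝ (Fin n))
    (i : Fin (n + 1)) (t : EuclideanSpace ℝ (Fin n)) :
    ∑ k, cornerWeights i t k • V k = cornerMap V i t := by
  simp [cornerWeights, Fin.sum_univ_succAbove _ i, cornerMap_apply, smul_sub, Finset.sum_smul,
    neg_add_eq_sub]

theorem IsRegularTwo.norm_cornerMap_sq {n : ℕ} {V : Fin (n + 1) → EuclideanSpace ℝ (Fin n)}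
    (hV : IsRegularTwo V) (i : Fin (n + 1)) (t : EuclideanSpace ℝ (Fin n)) :
    ‖cornerMap V i t‖ ^ 2 = cornerForm t := by
  rw [← sum_cornerWeights_smul, hV.norm_sq _ (sum_cornerWeights i t), cornerForm]
  simp [cornerWeights, Fin.sum_univ_succAbove _ i, add_comm]

theorem vertex_add_cornerMap_mem_solidSimplex {n : ℕ}
    (V : Fin (n + 1) → EuclideanSpace ℝ (Fin n)) (i : Fin (n + 1))
    {t : EuclideanSpace ℝ (Fin n)} (ht : t ∈ orthant n) (ht1 : ∑ j, t j ≤ 1) :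
    V i + cornerMap V i t ∈ solidSimplex V := by
  have h : V i + cornerMap V i t =
      ∑ k, (i.insertNth (1 - ∑ j, t j) t : Fin (n + 1) → ℝ) k • V k := by
    rw [Fin.sum_univ_succAbove _ i, cornerMap_apply]
    simp only [Fin.insertNth_apply_same, Fin.insertNth_apply_succAbove, smul_sub,
      Finset.sum_sub_distrib, sub_smul, one_smul, Finset.sum_smul]
    abel
  rw [h]
  refine (convex_convexHull ℝ _).sum_mem (fun k _ => ?_) ?_
    fun k _ => subset_convexHull ℝ _ (mem_range_self k)
  · rcases Fin.eq_self_or_eq_succAbove i k with rfl | ⟨j, rfl⟩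
    · simpa using ht1
    · simpa using ht j
  · simp [Fin.sum_univ_succAbove _ i]

/-- The corner coordinates are the barycentric coordinates at the other vertices. Their sum is also
at most 1, but the cap estimate needs only the cone. -/
theorem IsRegularTwo.exists_cornerMap_eq {n : ℕ} {V : Fin (n + 1) → EuclideanSpace ℝ (Fin n)}
    (hV : IsRegularTwo V) (i : Fin (n + 1)) {x : EuclideanSpace ℝ (Fin n)}
    (hx : V i + x ∈ solidSimplex V) : ∃ t ∈ orthant n, cornerMap V i t = x := by
  have hmem : V i + x ∈ convexHull ℝ (range hV.basis) := hx
  rw [AffineBasis.convexHull_eq_nonneg_coord] at hmem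
  set w : Fin (n + 1) → ℝ := fun k => hV.basis.coord k (V i + x)
  have hw1 : ∑ k, w k = 1 := hV.basis.sum_coord_apply_eq_one _
  have hwV : ∑ k, w k • V k = V i + x := hV.basis.linear_combination_coord_eq_self _
  rw [Fin.sum_univ_succAbove _ i] at hw1 hwV
  refine ⟨WithLp.toLp 2 fun j => w (i.succAbove j), fun j => hmem _, ?_⟩
  rw [← add_right_inj (V i), ← hwV, cornerMap_apply, eq_sub_of_add_eq hw1]
  simp only [smul_sub, Finset.sum_sub_distrib, sub_smul, one_smul, Finset.sum_smul]
  abel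

/-- The same determinant scales an upper bound for the cap and a lower bound for the simplex, so it
is eliminated without being computed. -/
theorem IsRegularTwo.volume_inter_closedBall_le {n : ℕ}
    {V : Fin (n + 1) → EuclideanSpace ℝ (Fin n)} (hV : IsRegularTwo V) (i : Fin (n + 1)) :
    volume (solidSimplex V ∩ Metric.closedBall (V i) 1) ≤
      volume (solidSimplex V) * (ENNReal.ofReal (n.factorial : ℝ) *
        volume (orthant n ∩ {t | cornerForm t ≤ 1})) := by
  set d := ENNReal.ofReal |LinearMap.det (cornerMap V i)|
  have hupper : volume (solidSimplex V ∩ Metric.closedBall (V i) 1) ≤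
      d * volume (orthant n ∩ {t | cornerForm t ≤ 1}) := by
    rw [← Measure.addHaar_image_linearMap, ← measure_preimage_add volume (V i)]
    refine measure_mono fun x hx => ?_
    obtain ⟨t, ht, rfl⟩ := hV.exists_cornerMap_eq i hx.1
    refine ⟨t, ⟨ht, ?_⟩, rfl⟩
    have hball := hx.2
    rw [Metric.mem_closedBall, dist_self_add_left] at hball
    rw [mem_ofPred_eq, ← hV.norm_cornerMap_sq i]
    exact pow_le_one₀ (norm_nonneg _) hball
  have hlower : d * volume (orthant n ∩ {t | ∑ j, t j ≤ 1}) ≤ volume (solidSimplex V) := by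
    rw [← Measure.addHaar_image_linearMap, ← measure_preimage_add volume (V i) (solidSimplex V)]
    refine measure_mono ?_
    rintro _ ⟨t, ⟨ht, ht1⟩, rfl⟩
    exact vertex_add_cornerMap_mem_solidSimplex V i ht ht1
  calc _ ≤ d * volume (orthant n ∩ {t | cornerForm t ≤ 1}) *
        (ENNReal.ofReal (n.factorial : ℝ) * volume (orthant n ∩ {t | ∑ j, t j ≤ 1})) := by
        rwa [factorial_mul_volume_orthant_sum_le_one, mul_one]
    _ = d * volume (orthant n ∩ {t | ∑ j, t j ≤ 1}) * (ENNReal.ofReal (n.factorial : ℝ) *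
        volume (orthant n ∩ {t | cornerForm t ≤ 1})) := by ring
    _ ≤ _ := by gcongr

theorem rogersConstant_le {n : ℕ} (hn : 1 ≤ n) :
    rogersConstant n ≤ (Real.exp 1 / (4 * (n : ℝ))) ^ ((n : ℝ) / 2) *
      ((n + 1).factorial : ℝ) / Real.Gamma (1 + (n : ℝ) / 2) := by
  have hV := isRegularTwo_regularVertices hn
  have hG : 0 < Real.Gamma (1 + (n : ℝ) / 2) := Real.Gamma_pos_of_pos (by positivity)
  set V := regularVertices n
  set B := (Real.exp 1 / (4 * (n : ℝ))) ^ ((n : ℝ) / 2)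
  have hB : 0 ≤ B := by positivity
  have hcap : volume (orthant n ∩ {t | cornerForm t ≤ 1}) ≤
      ENNReal.ofReal (B / Real.Gamma (1 + (n : ℝ) / 2)) := by
    rw [ENNReal.ofReal_div_of_pos hG, ENNReal.le_div_iff_mul_le
      (Or.inl (ENNReal.ofReal_pos.2 hG).ne') (Or.inl ENNReal.ofReal_ne_top), mul_comm]
    exact Gamma_mul_volume_cornerForm_le_one_le hn
  have hfin : volume (solidSimplex V) ≠ ⊤ :=
    (isBounded_convexHull.2 (finite_range V).isBounded).measure_lt_top.ne
  have hcov : volume (coveredPart V) ≤ volume (solidSimplex V) *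
      ENNReal.ofReal (B * ((n + 1).factorial : ℝ) / Real.Gamma (1 + (n : ℝ) / 2)) := by
    calc volume (coveredPart V)
        ≤ ∑ i, volume (solidSimplex V ∩ Metric.closedBall (V i) 1) :=
          measure_iUnion_fintype_le _ _
      _ ≤ ∑ _i : Fin (n + 1), volume (solidSimplex V) * (ENNReal.ofReal (n.factorial : ℝ) *
            ENNReal.ofReal (B / Real.Gamma (1 + (n : ℝ) / 2))) := by
          refine Finset.sum_le_sum fun i _ => (hV.volume_inter_closedBall_le i).trans ?_
          gcongr
      _ = _ := by
          rw [Finset.sum_const, Finset.card_univ, Fintype.card_fin, nsmul_eq_mul,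
            ← ENNReal.ofReal_natCast, ← ENNReal.ofReal_mul (by positivity), mul_left_comm,
            ← ENNReal.ofReal_mul (by positivity), Nat.factorial_succ]
          congr 2
          push_cast
          ring
  rw [rogersConstant, coveredRatio, div_le_iff₀ hV.volume_pos, mul_comm]
  have := ENNReal.toReal_mono (ENNReal.mul_ne_top hfin ENNReal.ofReal_ne_top) hcov
  rwa [ENNReal.toReal_mul, ENNReal.toReal_ofReal (by positivity)] at this

end Lenstra

/-! ### Numerical comparison of the two constants. -/

namespace Lenstra

/-- The threshold 56 comes from here: the base case is tight, with left side about 0.99, and the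
inequality fails at 55. Each further step multiplies by at most `0.95 (n + 2) / (n + 1)`, which is
at most 1 once `n ≥ 18`. -/
theorem add_one_mul_exp_one_div_pi_rpow_le_one {n : ℕ} (hn : 56 ≤ n) :
    ((n : ℝ) + 1) * (Real.exp 1 / Real.pi) ^ ((n : ℝ) / 2) ≤ 1 := by
  have hx0 : 0 < Real.exp 1 / Real.pi := div_pos (Real.exp_pos _) Real.pi_pos
  -- The quotient is about 0.865256; the base case leaves under one percent of room, so a coarse
  -- bound would not do.
  have hx : Real.exp 1 / Real.pi ≤ 0.86526 := by
    rw [div_le_iff₀ Real.pi_pos]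
    linarith [Real.exp_one_lt_d9, Real.pi_gt_d6]
  induction n, hn using Nat.le_induction with
  | base =>
    rw [show ((56 : ℕ) : ℝ) / 2 = (28 : ℕ) by norm_num, Real.rpow_natCast]
    calc _ ≤ (((56 : ℕ) : ℝ) + 1) * 0.86526 ^ 28 := by gcongr
      _ ≤ 1 := by norm_num
  | succ n hn ih =>
    have hroot : (Real.exp 1 / Real.pi) ^ ((1 : ℝ) / 2) ≤ 0.95 := by
      rw [← Real.sqrt_eq_rpow, Real.sqrt_le_left (by norm_num)]
      exact hx.trans (by norm_num)
    rw [Nat.cast_succ, add_div, Real.rpow_add hx0]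
    have hn' : (56 : ℝ) ≤ n := by exact_mod_cast hn
    have hpow : 0 ≤ (Real.exp 1 / Real.pi) ^ ((n : ℝ) / 2) := by positivity
    calc ((n : ℝ) + 1 + 1) * ((Real.exp 1 / Real.pi) ^ ((n : ℝ) / 2) *
          (Real.exp 1 / Real.pi) ^ ((1 : ℝ) / 2))
        ≤ ((n : ℝ) + 1 + 1) * ((Real.exp 1 / Real.pi) ^ ((n : ℝ) / 2) * 0.95) := by gcongr
      _ = (((n : ℝ) + 2) * 0.95) * (Real.exp 1 / Real.pi) ^ ((n : ℝ) / 2) := by ring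
      _ ≤ ((n : ℝ) + 1) * (Real.exp 1 / Real.pi) ^ ((n : ℝ) / 2) := by
        gcongr
        linarith
      _ ≤ 1 := ih

theorem deltaStarTwo_le_deltaStarOne {n : ℕ} (hn : 56 ≤ n) (s : ℕ)
    (hσ : rogersConstant n ≤ (Real.exp 1 / (4 * (n : ℝ))) ^ ((n : ℝ) / 2) *
      ((n + 1).factorial : ℝ) / Real.Gamma (1 + (n : ℝ) / 2)) :
    deltaStarTwo n ≤ deltaStarOne n s := by
  have hn0 : (0 : ℝ) < n := by
    have : 0 < n := by omega
    exact_mod_cast this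
  have hG : 0 < Real.Gamma (1 + (n : ℝ) / 2) := Real.Gamma_pos_of_pos (by positivity)
  have hpi := Real.pi_pos
  have he := Real.exp_pos 1
  have hnn : ((n : ℝ) ^ 2) ^ ((n : ℝ) / 2) = (n : ℝ) ^ n := by
    rw [← Real.rpow_two, ← Real.rpow_mul hn0.le, mul_div_cancel₀ _ two_ne_zero,
      Real.rpow_natCast]
  calc deltaStarTwo n
      ≤ (Real.exp 1 / (4 * (n : ℝ))) ^ ((n : ℝ) / 2) * ((n + 1).factorial : ℝ) /
          Real.Gamma (1 + (n : ℝ) / 2) * (4 / (Real.pi * n)) ^ ((n : ℝ) / 2) *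
          Real.Gamma (1 + (n : ℝ) / 2) := by
        unfold deltaStarTwo
        gcongr
    _ = ((n + 1).factorial : ℝ) * ((Real.exp 1 / (4 * (n : ℝ))) ^ ((n : ℝ) / 2) *
          (4 / (Real.pi * n)) ^ ((n : ℝ) / 2)) := by
        field_simp
    _ = ((n + 1).factorial : ℝ) * ((Real.exp 1 / Real.pi) ^ ((n : ℝ) / 2) / (n : ℝ) ^ n) := by
        rw [← Real.mul_rpow (by positivity) (by positivity), ← hnn,
          ← Real.div_rpow (by positivity) (by positivity)]
        congr 2
        field_simp
    _ = (n.factorial : ℝ) / (n : ℝ) ^ n *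
          (((n : ℝ) + 1) * (Real.exp 1 / Real.pi) ^ ((n : ℝ) / 2)) := by
        rw [Nat.factorial_succ]
        push_cast
        ring
    _ ≤ (n.factorial : ℝ) / (n : ℝ) ^ n * (4 / Real.pi) ^ s := by
        gcongr
        -- Since `π ≤ 4`, the case `s = 0` is the worst one.
        refine (add_one_mul_exp_one_div_pi_rpow_le_one hn).trans (one_le_pow₀ ?_)
        rw [one_le_div hpi]
        exact Real.pi_le_four

end Lenstra

theorem lemma3p1 :
    (∀ n : ℕ, 1 ≤ n →
      Lenstra.rogersConstant n ≤
        (Real.exp 1 / (4 * (n : ℝ))) ^ ((n : ℝ) / 2) * ((n + 1).factorial : ℝ) /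
          Real.Gamma (1 + (n : ℝ) / 2)) ∧
    (∀ n r s : ℕ, 56 ≤ n → n = r + 2 * s →
      Lenstra.deltaStarTwo n ≤ Lenstra.deltaStarOne n s) ∧
    (∀ (K : Type*) [Field K] [NumberField K], 56 ≤ Module.finrank ℚ K →
      Lenstra.CrossPolytopeCriterion K → Lenstra.SphereCriterion K) := by
  refine ⟨fun n hn => Lenstra.rogersConstant_le hn, fun n r s hn _ => ?_, fun K _ _ hK h => ?_⟩
  · exact Lenstra.deltaStarTwo_le_deltaStarOne hn s (Lenstra.rogersConstant_le (by omega))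
  · exact lt_of_le_of_lt (mul_le_mul_of_nonneg_right
      (Lenstra.deltaStarTwo_le_deltaStarOne hK _ (Lenstra.rogersConstant_le (by omega)))
      (Real.sqrt_nonneg _)) h
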